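/- Let $G$ be a finite group, let $N$ be a normal subgroup of $G$, and let $\theta \in \mathrm{Irr}(N)$ be $G$-invariant, where $\mathrm{Irr}(X)$ denotes the set of irreducible complex characters of a finite group $X$. Let $A$ be a subgroup of $G$ with $N \subseteq A \subseteq G$ such that $A/N$ is abelian. Suppose that $\theta$ has an extension $\varphi \in \mathrm{Irr}(A)$ (that is, the restriction $\varphi_N$ equals $\theta$) such that the induced character $\varphi^G$ is irreducible. Then $A$ is subnormal in $G$. -/

import Mathlib

/-- `Irr G`: the set of irreducible complex characters of `G`, that is, of the functions
`g ↦ trace (ρ g)` for the irreducible finite-dimensional complex representations `ρ` of `G`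
(up to isomorphism, `ρ` acts on `ℂⁿ`; an irreducible representation is nonzero). -/
def Irr (G : Type*) [Group G] : Set (G → ℂ) :=
  {χ | ∃ (n : ℕ) (ρ : Representation ℂ G (Fin n → ℂ)), ρ.IsIrreducible ∧ ρ.character = χ}

open scoped Classical in
/-- The induced function `φ^G` of a function `φ` on a subgroup `H` of a finite group `G`:
`φ^G (g) = |H|⁻¹ ∑_{x ∈ G} φ° (x g x⁻¹)`, where `φ°` is `φ` on `H` and `0` off `H`. -/
noncomputable def inducedCharacter {G : Type*} [Group G] [Fintype G] {H : Subgroup G}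
    (φ : H → ℂ) (g : G) : ℂ :=
  (Nat.card H : ℂ)⁻¹ *
    ∑ x : G, if h : x * g * x⁻¹ ∈ H then φ ⟨x * g * x⁻¹, h⟩ else 0

/-- A function `θ` on a normal subgroup `N` of `G` is `G`-invariant if
`θ (g n g⁻¹) = θ n` for all `g ∈ G` and `n ∈ N`. -/
def IsInvariantCharacter {G : Type*} [Group G] {N : Subgroup G} [N.Normal] (θ : N → ℂ) : Prop :=
  ∀ (g : G) (n : N), θ (MulAut.conjNormal g n) = θ n

/-! ### Subnormal subgroups and the zipper lemma -/

namespace Subgroup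
open scoped Pointwise

variable {G : Type*} [Group G]

/-! It suffices that g ∈ ⟨A, gAg⁻¹⟩ forces g ∈ A: `isSubnormal_of_mem_of_mem_sup_conj` then gives
subnormality via Wielandt's zipper lemma. Replace g by its inverse and put D = A ∩ g⁻¹Ag ≥ N. On D,
φ and its g-conjugate both extend θ, so they differ by a nonvanishing factor μ constant on N-cosets.
As A/N is abelian, A and g⁻¹Ag move elements of D only within N-cosets; A fixes φ, and g⁻¹Ag fixes
the conjugate and μ, hence also φ on D. So g fixes φ on D (`character_conj_eq_of_mem_sup`). But
irreducibility of φ^G makes the two restrictions disjoint when g ∉ A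
(`sum_zeroExtension_mul_conj_eq_zero`). -/

/-- The largest subgroup of `H` normalized by `T`. -/
def relCore (T H : Subgroup G) : Subgroup G where
  carrier := {x | ∀ t ∈ T, t * x * t⁻¹ ∈ H}
  one_mem' := by intro t _; simp
  mul_mem' := by
    intro a b ha hb t ht
    have := H.mul_mem (ha t ht) (hb t ht)
    simpa [mul_assoc] using this
  inv_mem' := by
    intro a ha t ht
    have := H.inv_mem (ha t ht)
    simpa [mul_assoc] using this

theorem mem_relCore {T H : Subgroup G} {x : G} :
    x ∈ relCore T H ↔ ∀ t ∈ T, t * x * t⁻¹ ∈ H := Iff.rfl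

theorem relCore_le (T H : Subgroup G) : relCore T H ≤ H := by
  intro x hx
  simpa using hx 1 T.one_mem

theorem relCore_mono (T : Subgroup G) {H K : Subgroup G} (h : H ≤ K) :
    relCore T H ≤ relCore T K := fun _ hx t ht => h (hx t ht)

theorem le_normalizer_of_conj_mem {H K : Subgroup G}
    (h : ∀ k ∈ K, ∀ x ∈ H, k * x * k⁻¹ ∈ H) : K ≤ normalizer (H : Set G) := by
  intro k hk
  rw [mem_normalizer_iff]
  refine fun x => ⟨h k hk x, fun hx => ?_⟩
  have := h k⁻¹ (K.inv_mem hk) _ hx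
  simpa [mul_assoc] using this

theorem le_normalizer_relCore (T H : Subgroup G) : T ≤ normalizer (relCore T H : Set G) := by
  refine le_normalizer_of_conj_mem fun t ht x hx s hs => ?_
  have := hx (s * t) (T.mul_mem hs ht)
  simpa [mul_assoc] using this

theorem relCore_eq_self {T H : Subgroup G} (h : T ≤ normalizer (H : Set G)) :
    relCore T H = H := by
  refine le_antisymm (relCore_le T H) fun x hx t ht => ?_
  exact (mem_normalizer_iff.mp (h ht) x).mp hx

theorem relCore_le_normalizer_relCore (T : Subgroup G) {H K : Subgroup G}
    (h : K ≤ normalizer (H : Set G)) : relCore T K ≤ normalizer (relCore T H : Set G) := by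
  refine le_normalizer_of_conj_mem fun k hk x hx t ht => ?_
  have := (mem_normalizer_iff.mp (h (hk t ht)) _).mp (hx t ht)
  simpa [mul_assoc] using this

theorem IsSubnormal.sup_of_normal {T : Subgroup G} (hT : T.IsSubnormal) (N : Subgroup G)
    [N.Normal] : (N ⊔ T).IsSubnormal := by
  have := (hT.quotient (K := N)).comap (QuotientGroup.mk' N)
  rwa [QuotientGroup.comap_map_mk'] at this

/-- The join of two subnormal subgroups is subnormal if one of them normalizes the other. -/
theorem IsSubnormal.sup_of_le_normalizer {S T : Subgroup G} (hS : S.IsSubnormal)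
    (hT : T.IsSubnormal) (hST : T ≤ normalizer (S : Set G)) : (S ⊔ T).IsSubnormal := by
  -- Taking T-cores along a subnormal chain from S to G keeps every term normalized by T.
  suffices h : (relCore T S ⊔ T).IsSubnormal by rwa [relCore_eq_self hST] at h
  clear hST
  induction hS with
  | top =>
    have : relCore T (⊤ : Subgroup G) = ⊤ := by ext; simp [mem_relCore]
    simp [this]
  | step H K hle _ hN ih =>
    have hHK : relCore T H ⊔ T ≤ relCore T K ⊔ T := sup_le_sup_right (relCore_mono T hle) T
    refine IsSubnormal.trans hHK ?_ ih
    rw [normal_subgroupOf_iff_le_normalizer hle] at hN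
    have hn : ((relCore T H).subgroupOf (relCore T K ⊔ T)).Normal := by
      rw [normal_subgroupOf_iff_le_normalizer (le_sup_left.trans hHK)]
      exact sup_le (relCore_le_normalizer_relCore T hN) (le_normalizer_relCore T H)
    rw [subgroupOf_sup (le_sup_left.trans hHK) le_sup_right]
    exact IsSubnormal.sup_of_normal hT.subgroupOf _

theorem IsSubnormal.subgroupOf_conj {A X : Subgroup G} (x : G)
    (h : (A.subgroupOf (MulAut.conj x⁻¹ • X)).IsSubnormal) :
    ((MulAut.conj x • A).subgroupOf X).IsSubnormal := by
  let f : X →* (MulAut.conj x⁻¹ • X : Subgroup G) :=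
    ((MulAut.conj x⁻¹).toMonoidHom.comp X.subtype).codRestrict _
      fun y => Subgroup.smul_mem_pointwise_smul (y : G) (MulAut.conj x⁻¹) X y.2
  have h2 := h.comap f
  convert h2 using 1
  ext y
  simp only [mem_subgroupOf, mem_comap, mem_pointwise_smul_iff_inv_smul_mem, ← map_inv]
  rfl

/-- In a subnormal chain above B, take x in the first term outside the normalizer; it normalizes the
previous term, which contains B. -/
theorem exists_conj_le_normalizer {B : Subgroup G} (hB : B.IsSubnormal) (hn : ¬ B.Normal) :
    ∃ x : G, MulAut.conj x • B ≤ normalizer (B : Set G) ∧ x ∉ normalizer (B : Set G) := by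
  suffices h : ∀ C : Subgroup G, C.IsSubnormal → B ≤ C → C ≤ normalizer (B : Set G) →
      ∃ x : G, MulAut.conj x • B ≤ normalizer (B : Set G) ∧ x ∉ normalizer (B : Set G) from
    h B hB le_rfl le_normalizer
  intro C hC
  induction hC with
  | top =>
    intro _ h
    exact absurd (normalizer_eq_top_iff.mp (top_le_iff.mp h)) hn
  | step H K hle _ hN ih =>
    intro hBH hH
    by_cases hK : K ≤ normalizer (B : Set G)
    · exact ih (hBH.trans hle) hK
    · obtain ⟨x, hxK, hx⟩ := SetLike.not_le_iff_exists.mp hK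
      refine ⟨x, ?_, hx⟩
      rw [normal_subgroupOf_iff_le_normalizer hle] at hN
      rintro _ ⟨b, hb, rfl⟩
      exact hH ((mem_normalizer_iff.mp (hN hxK) b).mp (hBH hb))

/-- **Wielandt's zipper lemma**. -/
theorem coatom_unique_of_not_isSubnormal [Finite G] (A : Subgroup G)
    (hsub : ∀ H : Subgroup G, A ≤ H → H ≠ ⊤ → (A.subgroupOf H).IsSubnormal)
    (hA : ¬ A.IsSubnormal) {M K : Subgroup G} (hM : IsCoatom M) (hK : IsCoatom K)
    (hAM : A ≤ M) (hAK : A ≤ K) : M = K := by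
  induction A using WellFoundedGT.induction generalizing M K with
  | ind A ih =>
  have hnt : normalizer (A : Set G) ≠ ⊤ := fun h =>
    hA (normalizer_eq_top_iff.mp h).isSubnormal
  obtain h | ⟨M₀, hM₀, hNM⟩ := eq_top_or_exists_le_coatom (normalizer (A : Set G))
  · exact absurd h hnt
  suffices key : ∀ K : Subgroup G, IsCoatom K → A ≤ K → M₀ = K from
    (key M hM hAM).symm.trans (key K hK hAK)
  clear hM hK hAM hAK M K
  intro K hK hAK
  by_cases hn : (A.subgroupOf K).Normal
  · rw [normal_subgroupOf_iff_le_normalizer hAK] at hn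
    have h := hn.trans hNM
    exact (hK.le_iff.mp h).resolve_left hM₀.1
  obtain ⟨⟨x, hxK⟩, hx1, hx2⟩ := exists_conj_le_normalizer (hsub K hAK hK.1) hn
  have hxN : x ∉ normalizer (A : Set G) := by
    intro h
    apply hx2
    rw [← subgroupOf_normalizer_eq hAK]
    exact h
  have hconjN : MulAut.conj x • A ≤ normalizer (A : Set G) := by
    rintro _ ⟨a, ha, rfl⟩
    have h1 : (⟨x, hxK⟩ * ⟨a, hAK ha⟩ * ⟨x, hxK⟩⁻¹ : K) ∈
        normalizer (A.subgroupOf K : Set K) := hx1 ⟨⟨a, hAK ha⟩, ha, rfl⟩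
    rw [← subgroupOf_normalizer_eq hAK] at h1
    exact h1
  have hconjK : MulAut.conj x • A ≤ K := by
    rintro _ ⟨a, ha, rfl⟩
    exact K.mul_mem (K.mul_mem hxK (hAK ha)) (K.inv_mem hxK)
  -- T is strictly larger than A and lies in both `M₀` and `K`, so the induction hypothesis
  -- identifies them.
  set T := A ⊔ MulAut.conj x • A with hT
  have hTN : T ≤ normalizer (A : Set G) := sup_le le_normalizer hconjN
  have hAT : A < T := by
    refine lt_of_le_of_ne le_sup_left fun h => hxN ?_
    have h1 : MulAut.conj x • A ≤ A := le_sup_right.trans h.ge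
    have h2 : MulAut.conj x • A = A := by
      exact eq_of_le_of_card_ge h1 (Nat.card_congr (equivSMul (MulAut.conj x) A).toEquiv).le
    rw [mem_normalizer_iff]
    intro y
    constructor
    · intro hy
      rw [← h2]
      exact ⟨y, hy, rfl⟩
    · intro hy
      rw [← h2] at hy
      obtain ⟨z, hz, hzy⟩ := hy
      have : z = y := by simpa using hzy
      exact this ▸ hz
  refine ih T hAT ?_ ?_ hM₀ hK (hTN.trans hNM) (sup_le hAK hconjK)
  · intro X hTX hX
    rw [hT, subgroupOf_sup (le_sup_left.trans hTX) (le_sup_right.trans hTX)]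
    refine IsSubnormal.sup_of_le_normalizer (hsub X (le_sup_left.trans hTX) hX) ?_ ?_
    -- x need not lie in X: use that A is subnormal in x⁻¹Xx, again a proper subgroup.
    · refine IsSubnormal.subgroupOf_conj x (hsub _ ?_ ?_)
      · rw [map_inv, subset_pointwise_smul_iff, inv_inv]
        exact le_sup_right.trans hTX
      · intro h
        apply hX
        rw [map_inv, inv_smul_eq_iff] at h
        rw [h]
        ext y
        simp
    · intro y hy
      have h1 : (y : G) ∈ normalizer (A : Set G) := hconjN hy
      rw [mem_normalizer_iff] at h1 ⊢
      intro z
      simpa [mem_subgroupOf] using h1 z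
  · intro h
    exact hA (IsSubnormal.step A T hAT.le h
      ((normal_subgroupOf_iff_le_normalizer hAT.le).mpr hTN))

/-- If `g ∈ ⟨A, gAg⁻¹⟩` only for `g ∈ A`, then `A` is subnormal. -/
theorem isSubnormal_of_mem_of_mem_sup_conj [Finite G] (A : Subgroup G)
    (h : ∀ g : G, g ∈ A ⊔ MulAut.conj g • A → g ∈ A) : A.IsSubnormal := by
  induction hn : Nat.card G using Nat.strong_induction_on generalizing G with
  | h n ih =>
  by_contra hA
  have hsub : ∀ H : Subgroup G, A ≤ H → H ≠ ⊤ → (A.subgroupOf H).IsSubnormal := by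
    intro H hAH hH
    refine ih (Nat.card H) ?_ (A.subgroupOf H) ?_ rfl
    · rw [← hn]
      refine lt_of_le_of_ne (Nat.le_of_dvd Nat.card_pos H.card_subgroup_dvd_card) fun he => ?_
      exact hH (eq_top_of_card_eq H he)
    · intro g hg
      apply h
      have h1 := mem_map_of_mem H.subtype hg
      rw [map_sup, map_subgroupOf_eq_of_le hAH] at h1
      refine sup_le_sup_left ?_ A h1
      rintro _ ⟨_, ⟨a, ha, rfl⟩, rfl⟩
      exact ⟨a, ha, rfl⟩
  have htop : A ≠ ⊤ := fun h => hA (h ▸ IsSubnormal.top)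
  obtain h' | ⟨M, hM, hAM⟩ := eq_top_or_exists_le_coatom A
  · exact htop h'
  -- If the join is G then g ∈ A; otherwise a maximal subgroup above it must be M.
  have hconj : ∀ g : G, MulAut.conj g • A ≤ M := by
    intro g
    obtain h' | ⟨K, hK, hAK⟩ := eq_top_or_exists_le_coatom (A ⊔ MulAut.conj g • A)
    · have hg : g ∈ A := h g (h' ▸ mem_top g)
      rintro _ ⟨a, ha, rfl⟩
      exact hAM (A.mul_mem (A.mul_mem hg ha) (A.inv_mem hg))
    · rw [coatom_unique_of_not_isSubnormal A hsub hA hM hK hAM (le_sup_left.trans hAK)]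
      exact le_sup_right.trans hAK
  have hC : normalClosure (A : Set G) ≤ M := by
    rw [normalClosure, closure_le]
    intro y hy
    obtain ⟨a, ha, hay⟩ := Group.mem_conjugatesOfSet_iff.mp hy
    obtain ⟨c, rfl⟩ := isConj_iff.mp hay
    exact hconj c ⟨a, ha, rfl⟩
  refine hA (IsSubnormal.trans le_normalClosure (hsub _ le_normalClosure fun h => ?_)
    normalClosure_normal.isSubnormal)
  exact hM.1 (top_le_iff.mp (h ▸ hC))

end Subgroup

/-! ### Extensions of an irreducible character -/

namespace Representation

open Module

variable {W V V' : Type*} [AddCommGroup W] [Module ℂ W] [FiniteDimensional ℂ W]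
  [AddCommGroup V] [Module ℂ V] [FiniteDimensional ℂ V]
  [AddCommGroup V'] [Module ℂ V'] [FiniteDimensional ℂ V']

theorem sum_character_mul_character_inv {D : Type*} [Group D] [Fintype D]
    (ρ : Representation ℂ D V) (σ : Representation ℂ D V') :
    ∑ d : D, σ.character d * ρ.character d⁻¹ =
      ((Nat.card D * finrank ℂ (IntertwiningMap ρ σ) : ℕ) : ℂ) := by
  have hc : (Nat.card D : ℂ) ≠ 0 := Nat.cast_ne_zero.mpr Nat.card_pos.ne'
  let := invertibleOfNonzero hc
  rw [Nat.cast_mul, ← card_inv_mul_sum_char_mul_char_eq_finrank, mul_inv_cancel_left₀ hc]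

theorem sum_character_mul_character_inv_self {D : Type*} [Group D] [Fintype D]
    (ρ : Representation ℂ D V) [ρ.IsIrreducible] :
    ∑ d : D, ρ.character d * ρ.character d⁻¹ = Nat.card D := by
  rw [sum_character_mul_character_inv]
  simp

theorem nontrivial_of_isIrreducible {N U : Type*} [Group N] [AddCommGroup U] [Module ℂ U]
    (π : Representation ℂ N U) [π.IsIrreducible] : Nontrivial U := by
  by_contra hs
  rw [not_nontrivial_iff_subsingleton] at hs
  exact bot_ne_top (α := Subrepresentation π)
    (SetLike.ext fun x => by rw [Subsingleton.elim x 0]; exact ⟨fun _ => True.intro, fun _ => rfl⟩)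

theorem finrank_intertwiningMap_self_ne_zero {D : Type*} [Group D] [Nontrivial V]
    (ρ : Representation ℂ D V) : finrank ℂ (IntertwiningMap ρ ρ) ≠ 0 := by
  have := Module.Finite.equiv (invariantsEquivIntertwiningMap ρ ρ)
  intro h
  rw [finrank_zero_iff] at h
  obtain ⟨v, hv⟩ := exists_ne (0 : V)
  exact hv (congrArg (fun f : IntertwiningMap ρ ρ => f v)
    (Subsingleton.elim (⟨LinearMap.id, fun _ => rfl⟩ : IntertwiningMap ρ ρ) 0))

/-- A representation with the same character as an irreducible one is isomorphic to it. -/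
theorem exists_linearEquiv_of_character_eq {N : Type*} [Group N] [Finite N]
    (π : Representation ℂ N W) [π.IsIrreducible] (τ : Representation ℂ N V)
    (h : τ.character = π.character) :
    ∃ e : W ≃ₗ[ℂ] V, ∀ n w, e (π n w) = τ n (e w) := by
  have := Fintype.ofFinite N
  have hne : finrank ℂ (IntertwiningMap π τ) ≠ 0 := by
    have h1 := sum_character_mul_character_inv π τ
    rw [h, sum_character_mul_character_inv_self] at h1
    intro h0
    rw [h0, mul_zero, Nat.cast_inj] at h1
    exact Nat.card_pos.ne' h1
  have : Nontrivial (IntertwiningMap π τ) := by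
    by_contra hs
    rw [not_nontrivial_iff_subsingleton] at hs
    exact hne finrank_zero_of_subsingleton
  obtain ⟨f, hf⟩ := exists_ne (0 : IntertwiningMap π τ)
  have hinj := (IsIrreducible.injective_or_eq_zero f).resolve_right hf
  have hdim : finrank ℂ W = finrank ℂ V := by
    have h1 := congrFun h 1
    rw [char_one, char_one, Nat.cast_inj] at h1
    exact h1.symm
  exact ⟨LinearEquiv.ofInjectiveOfFinrankEq f.toLinearMap hinj hdim, f.isIntertwining⟩

/-- Two representations that agree on a normal subgroup, on which they are irreducible, differ by
scalars that only depend on the cosets of the subgroup. -/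
theorem exists_smul_of_eq_on_normal {N D : Type*} [Group N] [Group D] (ι : N →* D)
    (hι : ∀ d n, ∃ m, d * ι n * d⁻¹ = ι m) (π : Representation ℂ N W) [π.IsIrreducible]
    (σ σ' : Representation ℂ D W) (hσ : ∀ n, σ (ι n) = π n) (hσ' : ∀ n, σ' (ι n) = π n) :
    ∃ μ : D → ℂ, (∀ d, μ d ≠ 0) ∧ (∀ d, σ' d = μ d • σ d) ∧ ∀ d n, μ (d * ι n) = μ d := by
  have hW := nontrivial_of_isIrreducible π
  -- Both operators conjugate π in the same way, so Schur's lemma applies.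
  have key : ∀ d, ∃ c : ℂ, σ' d * σ d⁻¹ = c • 1 := by
    intro d
    have hcomm : ∀ n, (σ' d * σ d⁻¹) ∘ₗ π n = π n ∘ₗ (σ' d * σ d⁻¹) := by
      intro n
      obtain ⟨m, hm⟩ := hι d⁻¹ n
      rw [inv_inv] at hm
      change σ' d * σ d⁻¹ * π n = π n * (σ' d * σ d⁻¹)
      have h1 : d⁻¹ * ι n = ι m * d⁻¹ := by rw [← hm]; group
      have h2 : d * ι m = ι n * d := by rw [← hm]; group
      rw [← hσ n, mul_assoc, ← map_mul, h1, map_mul, hσ, ← hσ' m, ← mul_assoc, ← map_mul, h2,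
        map_mul, hσ', hσ, mul_assoc]
    obtain ⟨c, hc⟩ := (IsIrreducible.algebraMap_intertwiningMap_bijective_of_isAlgClosed
      (ρ := π)).2 ⟨σ' d * σ d⁻¹, hcomm⟩
    refine ⟨c, ?_⟩
    have := congrArg IntertwiningMap.toLinearMap hc
    rw [Algebra.algebraMap_eq_smul_one] at this
    exact this.symm
  choose μ hμ using key
  have hμ' : ∀ d, σ' d = μ d • σ d := by
    intro d
    have h1 := congrArg (· * σ d) (hμ d)
    simpa [mul_assoc, ← map_mul] using h1
  have hinv : ∀ d, σ' d ≠ 0 := by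
    intro d h0
    have h1 : σ' (d * d⁻¹) = 0 := by rw [map_mul, h0, zero_mul]
    rw [mul_inv_cancel, map_one] at h1
    exact one_ne_zero h1
  refine ⟨μ, fun d h0 => hinv d (by rw [hμ' d, h0, zero_smul]), hμ', fun d n => ?_⟩
  have h1 : μ (d * ι n) • (1 : W →ₗ[ℂ] W) = μ d • 1 := by
    rw [← hμ, ← hμ, mul_inv_rev, map_mul, map_mul, hσ', ← map_inv ι, hσ, mul_assoc,
      ← mul_assoc (π n), ← map_mul, mul_inv_cancel, map_one, one_mul]
  exact smul_left_injective ℂ (one_ne_zero (α := Module.End ℂ W)) h1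

/-- Two characters extending the same irreducible character of a normal subgroup differ by nonzero
factors that only depend on the cosets of the subgroup. -/
theorem exists_character_eq_mul_of_extension {N D : Type*} [Group N] [Finite N] [Group D]
    (ι : N →* D) (hι : ∀ d n, ∃ m, d * ι n * d⁻¹ = ι m) (π : Representation ℂ N W)
    [π.IsIrreducible] (ρ : Representation ℂ D V) (ρ' : Representation ℂ D V')
    (hρ : ∀ n, ρ.character (ι n) = π.character n)
    (hρ' : ∀ n, ρ'.character (ι n) = π.character n) :
    ∃ μ : D → ℂ, (∀ d, μ d ≠ 0) ∧ (∀ d, ρ'.character d = μ d * ρ.character d) ∧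
      ∀ d n, μ (d * ι n) = μ d := by
  obtain ⟨e, he⟩ := exists_linearEquiv_of_character_eq π (ρ.comp ι) (funext hρ)
  obtain ⟨e', he'⟩ := exists_linearEquiv_of_character_eq π (ρ'.comp ι) (funext hρ')
  let σ : Representation ℂ D W := (e.symm.conjRingEquiv : Module.End ℂ V →* Module.End ℂ W).comp ρ
  let σ' : Representation ℂ D W := (e'.symm.conjRingEquiv : Module.End ℂ V' →* Module.End ℂ W).comp ρ'
  obtain ⟨μ, h0, h1, h2⟩ := exists_smul_of_eq_on_normal ι hι π σ σ'
    (fun n => LinearMap.ext fun w => (e.symm_apply_eq).mpr (he n w).symm)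
    (fun n => LinearMap.ext fun w => (e'.symm_apply_eq).mpr (he' n w).symm)
  refine ⟨μ, h0, fun d => ?_, h2⟩
  have h3 := congrArg (LinearMap.trace ℂ W) (h1 d)
  rw [map_smul, smul_eq_mul] at h3
  have h4 : LinearMap.trace ℂ W (σ d) = ρ.character d := LinearMap.trace_conj' (ρ d) e.symm
  have h5 : LinearMap.trace ℂ W (σ' d) = ρ'.character d := LinearMap.trace_conj' (ρ' d) e'.symm
  rw [← h4, ← h5, h3]

end Representation

/-! ### The norm of an induced character -/

section InducedCharacter

variable {G : Type*} [Group G]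

open scoped Classical in
/-- The extension by zero of a function on a subgroup. -/
noncomputable def Subgroup.zeroExtension {H : Subgroup G} (φ : H → ℂ) (x : G) : ℂ :=
  if h : x ∈ H then φ ⟨x, h⟩ else 0

theorem Subgroup.zeroExtension_of_mem {H : Subgroup G} (φ : H → ℂ) {x : G} (h : x ∈ H) :
    zeroExtension φ x = φ ⟨x, h⟩ := dif_pos h

theorem Subgroup.zeroExtension_of_notMem {H : Subgroup G} (φ : H → ℂ) {x : G} (h : x ∉ H) :
    zeroExtension φ x = 0 := dif_neg h

open Subgroup

/-- The subgroup `A ∩ g⁻¹Ag`. -/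
def Subgroup.infConj (A : Subgroup G) (g : G) : Subgroup G :=
  A ⊓ A.comap (MulAut.conj g).toMonoidHom

theorem Subgroup.infConj_le (A : Subgroup G) (g : G) : A.infConj g ≤ A := inf_le_left

theorem Subgroup.conj_mem_of_mem_infConj {A : Subgroup G} {g x : G} (h : x ∈ A.infConj g) :
    g * x * g⁻¹ ∈ A := h.2

/-- Conjugation by `g` as a homomorphism `A ∩ g⁻¹Ag → A`. -/
def Subgroup.infConjHom (A : Subgroup G) (g : G) : A.infConj g →* A :=
  ((MulAut.conj g).toMonoidHom.comp (A.infConj g).subtype).codRestrict A fun x => conj_mem_of_mem_infConj x.2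

variable [Fintype G]

open scoped Classical in
/-- The sum over `A ∩ y⁻¹Ay` of the product of `φ` with the contragredient of its conjugate. -/
theorem sum_zeroExtension_mul_conj {A : Subgroup G} (φ : A → ℂ) (y : G) :
    ∑ g : G, zeroExtension φ g * zeroExtension φ (y * g⁻¹ * y⁻¹) =
      ∑ d : A.infConj y, φ (inclusion (A.infConj_le y) d) * φ (A.infConjHom y d⁻¹) := by
  symm
  refine Fintype.sum_of_injective (fun d : A.infConj y => (d : G)) Subtype.coe_injective _ _ ?_ ?_
  · intro g hg
    by_cases h1 : g ∈ A
    · by_cases h2 : y * g⁻¹ * y⁻¹ ∈ A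
      · refine absurd ⟨⟨g, h1, ?_⟩, rfl⟩ hg
        have := A.inv_mem h2
        simpa [mul_assoc] using this
      · rw [zeroExtension_of_notMem φ h2, mul_zero]
    · rw [zeroExtension_of_notMem φ h1, zero_mul]
  · intro d
    have h : y * (d : G)⁻¹ * y⁻¹ ∈ A := (A.infConjHom y d⁻¹).2
    rw [zeroExtension_of_mem φ (A.infConj_le y d.2), zeroExtension_of_mem φ h]
    rfl

variable {n : ℕ} {A : Subgroup G}

theorem exists_nat_sum_zeroExtension_mul_conj (ρ : Representation ℂ A (Fin n → ℂ)) (y : G) :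
    ∃ s : ℕ, ∑ g : G, zeroExtension ρ.character g * zeroExtension ρ.character (y * g⁻¹ * y⁻¹) =
      s := by
  classical
  rw [sum_zeroExtension_mul_conj]
  exact ⟨_, Representation.sum_character_mul_character_inv (ρ.comp (A.infConjHom y))
    (ρ.comp (inclusion (A.infConj_le y)))⟩

theorem sum_zeroExtension_mul_conj_of_mem (ρ : Representation ℂ A (Fin n → ℂ))
    [ρ.IsIrreducible] {y : G} (hy : y ∈ A) :
    ∑ g : G, zeroExtension ρ.character g * zeroExtension ρ.character (y * g⁻¹ * y⁻¹) =
      Nat.card A := by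
  classical
  rw [← Representation.sum_character_mul_character_inv_self ρ]
  symm
  refine Fintype.sum_of_injective (fun d : A => (d : G)) Subtype.coe_injective _ _ ?_ ?_
  · intro g hg
    have h1 : g ∉ A := fun h => hg ⟨⟨g, h⟩, rfl⟩
    rw [zeroExtension_of_notMem _ h1, zero_mul]
  · intro d
    have h2 : y * (d : G)⁻¹ * y⁻¹ ∈ A := A.mul_mem (A.mul_mem hy (A.inv_mem d.2)) (A.inv_mem hy)
    rw [zeroExtension_of_mem _ d.2, zeroExtension_of_mem _ h2,
      ← Representation.char_conj ρ d⁻¹ ⟨y, hy⟩]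
    rfl

/-- Replacing y by yx and then xgx⁻¹ by g removes x from the summand, whence the factor |G|. -/
theorem sum_inducedCharacter_mul_inv (φ : A → ℂ) :
    (Nat.card A : ℂ) ^ 2 * ∑ g : G, inducedCharacter φ g * inducedCharacter φ g⁻¹ =
      Nat.card G *
        ∑ y : G, ∑ g : G, zeroExtension φ g * zeroExtension φ (y * g⁻¹ * y⁻¹) := by
  have hc : (Nat.card A : ℂ) ≠ 0 := Nat.cast_ne_zero.mpr Nat.card_pos.ne'
  have h1 : ∀ g, (Nat.card A : ℂ) * inducedCharacter φ g =
      ∑ x : G, zeroExtension φ (x * g * x⁻¹) := by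
    intro g
    rw [inducedCharacter, mul_inv_cancel_left₀ hc]
    rfl
  calc (Nat.card A : ℂ) ^ 2 * ∑ g : G, inducedCharacter φ g * inducedCharacter φ g⁻¹
      = ∑ g : G, ∑ x : G, ∑ y : G,
          zeroExtension φ (x * g * x⁻¹) * zeroExtension φ (y * g⁻¹ * y⁻¹) := by
        rw [Finset.mul_sum]
        refine Finset.sum_congr rfl fun g _ => ?_
        rw [← Finset.sum_mul_sum, ← h1, ← h1]
        ring
    _ = ∑ x : G, ∑ y : G, ∑ g : G,
          zeroExtension φ (x * g * x⁻¹) * zeroExtension φ (y * g⁻¹ * y⁻¹) := by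
        rw [Finset.sum_comm]
        exact Finset.sum_congr rfl fun x _ => Finset.sum_comm
    _ = ∑ x : G, ∑ y : G, ∑ g : G, zeroExtension φ g * zeroExtension φ (y * g⁻¹ * y⁻¹) := by
        refine Finset.sum_congr rfl fun x _ => ?_
        rw [← Equiv.sum_comp (Equiv.mulRight x)]
        refine Finset.sum_congr rfl fun y _ => ?_
        rw [← Equiv.sum_comp (MulAut.conj x).toEquiv fun g =>
          zeroExtension φ g * zeroExtension φ (y * g⁻¹ * y⁻¹)]
        refine Finset.sum_congr rfl fun g _ => ?_
        congr 2
        simp [mul_assoc]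
    _ = _ := by simp

/-- If the induced character is irreducible, then the conjugates of the character by elements
outside the subgroup have no constituents in common with it. -/
theorem sum_zeroExtension_mul_conj_eq_zero (ρ : Representation ℂ A (Fin n → ℂ))
    [ρ.IsIrreducible] (hind : inducedCharacter ρ.character ∈ Irr G) {y : G} (hy : y ∉ A) :
    ∑ g : G, zeroExtension ρ.character g * zeroExtension ρ.character (y * g⁻¹ * y⁻¹) = 0 := by
  classical
  choose s hs using exists_nat_sum_zeroExtension_mul_conj ρ
  obtain ⟨m, π, hπ, hχ⟩ := hind
  have hG : (Nat.card G : ℂ) ≠ 0 := Nat.cast_ne_zero.mpr Nat.card_pos.ne'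
  have h1 := sum_inducedCharacter_mul_inv ρ.character
  rw [← hχ, Representation.sum_character_mul_character_inv_self, mul_comm] at h1
  have h2 := mul_left_cancel₀ hG h1
  simp_rw [hs] at h2
  -- The terms with y ∈ A already add up to |A|², so the other natural numbers vanish.
  have h3 : Nat.card A ^ 2 = ∑ y, s y := by exact_mod_cast h2
  have h4 : ∀ a ∈ A, s a = Nat.card A := fun a ha => by
    have := (hs a).symm.trans (sum_zeroExtension_mul_conj_of_mem ρ ha)
    exact_mod_cast this
  have h5 : ∑ y with y ∈ A, s y = Nat.card A ^ 2 := by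
    rw [Finset.sum_congr rfl fun a ha => h4 a (Finset.mem_filter.mp ha).2, Finset.sum_const,
      smul_eq_mul, sq, ← Fintype.card_subtype, Nat.card_eq_fintype_card]
  rw [← Finset.sum_filter_add_sum_filter_not _ (· ∈ A), h5] at h3
  have h6 : ∑ y with y ∉ A, s y = 0 := by omega
  have h7 := Finset.sum_eq_zero_iff.mp h6 y (by simpa using hy)
  rw [hs, h7, Nat.cast_zero]

end InducedCharacter

/-! ### The stabilizer argument and the conclusion -/

namespace Subgroup

variable {G : Type*} [Group G]

/-- The elements that preserve a subset `D` and a function on it under conjugation. -/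
def conjStabilizerOn {α : Type*} (D : Set G) (F : G → α) : Subgroup G where
  carrier := {h | ∀ x, (h * x * h⁻¹ ∈ D ↔ x ∈ D) ∧ (x ∈ D → F (h * x * h⁻¹) = F x)}
  one_mem' := by intro x; simp
  mul_mem' := by
    intro a b ha hb x
    have h : a * b * x * (a * b)⁻¹ = a * (b * x * b⁻¹) * a⁻¹ := by group
    rw [h]
    exact ⟨(ha _).1.trans (hb x).1, fun hx =>
      ((ha _).2 ((hb x).1.mpr hx)).trans ((hb x).2 hx)⟩
  inv_mem' := by
    intro a ha x
    obtain ⟨h1, h2⟩ := ha (a⁻¹ * x * a⁻¹⁻¹)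
    have h : a * (a⁻¹ * x * a⁻¹⁻¹) * a⁻¹ = x := by group
    rw [h] at h1 h2
    exact ⟨h1.symm, fun hx => (h2 (h1.mp hx)).symm⟩

theorem le_conjStabilizerOn {α : Type*} {B : Subgroup G} {D : Set G} {F : G → α}
    (h : ∀ b ∈ B, ∀ x ∈ D, b * x * b⁻¹ ∈ D ∧ F (b * x * b⁻¹) = F x) :
    B ≤ conjStabilizerOn D F := by
  refine fun b hb x => ⟨⟨fun hx => ?_, fun hx => (h b hb x hx).1⟩, fun hx => (h b hb x hx).2⟩
  have := (h b⁻¹ (B.inv_mem hb) _ hx).1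
  simpa [mul_assoc] using this

end Subgroup

open Subgroup in
/-- If `g ∈ ⟨A, gAg⁻¹⟩`, the conjugate of `φ` by `g` coincides with `φ` on `A ∩ g⁻¹Ag`. -/
theorem character_conj_eq_of_mem_sup {G : Type*} [Group G] [Finite G] (N A : Subgroup G)
    [N.Normal] (hNA : N ≤ A) (hcomm : ∀ a ∈ A, ∀ b ∈ A, a⁻¹ * b * a * b⁻¹ ∈ N) {n m : ℕ}
    (π : Representation ℂ N (Fin m → ℂ)) [π.IsIrreducible]
    (hinv : IsInvariantCharacter π.character) (ρ : Representation ℂ A (Fin n → ℂ))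
    (hext : ∀ x : N, ρ.character (inclusion hNA x) = π.character x) {g : G}
    (hg : g ∈ A ⊔ A.comap (MulAut.conj g).toMonoidHom) (d : A.infConj g) :
    ρ.character (A.infConjHom g d) = ρ.character (inclusion (A.infConj_le g) d) := by
  have hgN : ∀ x ∈ N, g * x * g⁻¹ ∈ N := fun x hx => Normal.conj_mem inferInstance x hx g
  have hND : N ≤ A.infConj g := fun x hx => ⟨hNA hx, hNA (hgN x hx)⟩
  obtain ⟨μ, hμ0, hμ, hμN⟩ := Representation.exists_character_eq_mul_of_extension
    (inclusion hND) (fun d x => ⟨⟨d * x * d⁻¹, Normal.conj_mem inferInstance _ x.2 _⟩, rfl⟩) π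
    (ρ.comp (inclusion (A.infConj_le g))) (ρ.comp (A.infConjHom g)) hext
    (fun x => (hext ⟨g * x * g⁻¹, hgN x x.2⟩).trans (hinv g x))
  set F := zeroExtension ρ.character with hF
  have hFA : ∀ b ∈ A, ∀ x ∈ A, F (b * x * b⁻¹) = F x := by
    intro b hb x hx
    rw [hF, zeroExtension_of_mem _ hx,
      zeroExtension_of_mem _ (A.mul_mem (A.mul_mem hb hx) (A.inv_mem hb))]
    exact ρ.char_conj ⟨x, hx⟩ ⟨b, hb⟩
  have hmul : ∀ x (hx : x ∈ A.infConj g), F (g * x * g⁻¹) = μ ⟨x, hx⟩ * F x := by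
    intro x hx
    rw [hF, zeroExtension_of_mem _ (A.infConj_le g hx),
      zeroExtension_of_mem _ (conj_mem_of_mem_infConj hx)]
    exact hμ ⟨x, hx⟩
  have hcoset : ∀ x (hx : x ∈ A.infConj g) (y) (hy : y ∈ A.infConj g), x⁻¹ * y ∈ N →
      μ ⟨y, hy⟩ = μ ⟨x, hx⟩ := by
    intro x hx y hy hxy
    rw [← hμN ⟨x, hx⟩ ⟨_, hxy⟩]
    congr 1
    ext
    simp
  have hA : A ≤ conjStabilizerOn (A.infConj g) F := by
    refine le_conjStabilizerOn fun b hb x hx => ⟨?_, hFA b hb x hx.1⟩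
    have h : b * x * b⁻¹ = x * (x⁻¹ * b * x * b⁻¹) := by group
    rw [h]
    exact mul_mem hx (hND (hcomm x hx.1 b hb))
  have hA' : A.comap (MulAut.conj g).toMonoidHom ≤ conjStabilizerOn (A.infConj g) F := by
    refine le_conjStabilizerOn fun b hb x hx => ?_
    have hb' : g * b * g⁻¹ ∈ A := hb
    have hN : x⁻¹ * b * x * b⁻¹ ∈ N := by
      have h := hcomm _ hx.2 _ hb'
      have h' := Normal.conj_mem (H := N) inferInstance _ h g⁻¹
      convert h' using 1
      simp only [MulEquiv.toMonoidHom_eq_coe, MonoidHom.coe_coe, MulAut.conj_apply]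
      group
    have h : b * x * b⁻¹ = x * (x⁻¹ * b * x * b⁻¹) := by group
    have hbx : b * x * b⁻¹ ∈ A.infConj g := by
      rw [h]
      exact mul_mem hx (hND hN)
    refine ⟨hbx, ?_⟩
    have h1 : g * (b * x * b⁻¹) * g⁻¹ = (g * b * g⁻¹) * (g * x * g⁻¹) * (g * b * g⁻¹)⁻¹ := by
      group
    have h2 := hmul _ hbx
    rw [h1, hFA _ hb' _ (conj_mem_of_mem_infConj hx), hmul x hx, hcoset x hx _ hbx (by rw [h]; simpa using hN)] at h2
    -- The conjugate of φ and μ take equal values at x and bxb⁻¹; cancelling μ leaves φ.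
    exact (mul_left_cancel₀ (hμ0 _) h2).symm
  have h := ((sup_le hA hA' hg) d).2 d.2
  rw [hF, zeroExtension_of_mem _ (A.infConj_le g d.2),
    zeroExtension_of_mem _ (conj_mem_of_mem_infConj d.2)] at h
  exact h

theorem corollary6p3 {G : Type*} [Group G] [Fintype G] (N A : Subgroup G) [N.Normal]
    (hNA : N ≤ A) (hab : ∀ x y : A ⧸ N.subgroupOf A, x * y = y * x)
    (θ : N → ℂ) (hθ : θ ∈ Irr N) (hinv : IsInvariantCharacter θ)
    (φ : A → ℂ) (hφ : φ ∈ Irr A) (hext : ∀ n : N, φ (Subgroup.inclusion hNA n) = θ n)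
    (hind : inducedCharacter φ ∈ Irr G) :
    A.IsSubnormal := by
  classical
  obtain ⟨m, π, hπ, rfl⟩ := hθ
  obtain ⟨n, ρ, hρ, rfl⟩ := hφ
  have hcomm : ∀ a ∈ A, ∀ b ∈ A, a⁻¹ * b * a * b⁻¹ ∈ N := by
    intro a ha b hb
    have h := hab (QuotientGroup.mk ⟨b, hb⟩⁻¹) (QuotientGroup.mk ⟨a, ha⟩)
    rw [← QuotientGroup.mk_mul, ← QuotientGroup.mk_mul, QuotientGroup.eq] at h
    have h1 : (b⁻¹ * a)⁻¹ * (a * b⁻¹) ∈ N := h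
    simpa [mul_assoc] using h1
  refine Subgroup.isSubnormal_of_mem_of_mem_sup_conj A fun g hg => ?_
  by_contra hgA
  -- The criterion uses gAg⁻¹ but `infConj` uses g⁻¹Ag, hence the inverse.
  have hg' : g⁻¹ ∈ A ⊔ A.comap (MulAut.conj g⁻¹).toMonoidHom := by
    refine inv_mem (sup_le_sup_left ?_ A hg)
    rintro _ ⟨a, ha, rfl⟩
    simpa [mul_assoc] using ha
  have h0 := sum_zeroExtension_mul_conj_eq_zero ρ hind (y := g⁻¹) (by simpa using hgA)
  rw [sum_zeroExtension_mul_conj] at h0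
  simp_rw [character_conj_eq_of_mem_sup N A hNA hcomm π hinv ρ hext hg'] at h0
  -- The vanishing sum is now |D| times the dimension of the endomorphisms of ρ on D, which is
  -- positive.
  have h1 := Representation.sum_character_mul_character_inv
    (ρ.comp (Subgroup.inclusion (A.infConj_le g⁻¹)))
    (ρ.comp (Subgroup.inclusion (A.infConj_le g⁻¹)))
  have h2 := h1.symm.trans h0
  rw [Nat.cast_eq_zero, mul_eq_zero] at h2
  have := Representation.nontrivial_of_isIrreducible ρ
  exact h2.elim Nat.card_pos.ne' (Representation.finrank_intertwiningMap_self_ne_zero _)
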